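/- Let $T$ be a complete first-order theory in a countable language $L$ that is $\omega$-categorical, i.e. any two countably infinite models of $T$ are isomorphic. For a natural number $n$, an $L$-formula is called an *$n$-formula* of $T$ if it is $T$-equivalent to a Boolean combination of $L$-formulas each of which has at most $n$ free variables. The theory $T$ is called *almost $n$-ary* if there are finitely many $L$-formulas $\varphi_1(\overline{x}),\ldots,\varphi_m(\overline{x})$ such that every $L$-formula is $T$-equivalent to a Boolean combination of $n$-formulas and of formulas obtained from $\varphi_1,\ldots,\varphi_m$ by substituting variables (not necessarily distinct) for their free variables. Let $\mathrm{aar}(T)$ be the least $n\ge 1$ such that $T$ is almost $n$-ary, with $\mathrm{aar}(T)=\infty$ if there is no such $n$. If $T$ is almost $n$-ary for some natural number $n$, then $T$ is almost $k$-ary for every natural number $k\ge 1$; consequently $\mathrm{aar}(T)=1$. -/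

import Mathlib

universe u v w

namespace AlmostArity

open FirstOrder FirstOrder.Language

variable {L : FirstOrder.Language.{u, v}}

/-- `IsBooleanCombination S φ`: the formula `φ` is a Boolean combination of formulas
from the set `S` (the constants false and true being allowed). -/
inductive IsBooleanCombination (S : Set (L.Formula ℕ)) : L.Formula ℕ → Prop
  | of {φ : L.Formula ℕ} (h : φ ∈ S) : IsBooleanCombination S φ
  | falsum : IsBooleanCombination S ⊥
  | neg {φ : L.Formula ℕ} (h : IsBooleanCombination S φ) : IsBooleanCombination S φ.not
  | conj {φ ψ : L.Formula ℕ} (h₁ : IsBooleanCombination S φ) (h₂ : IsBooleanCombination S ψ) :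
      IsBooleanCombination S (φ ⊓ ψ)
  | disj {φ ψ : L.Formula ℕ} (h₁ : IsBooleanCombination S φ) (h₂ : IsBooleanCombination S ψ) :
      IsBooleanCombination S (φ ⊔ ψ)

/-- `φ` is equivalent, modulo the theory `T`, to a Boolean combination of formulas from `S`. -/
def IsBasedOn (T : L.Theory) (S : Set (L.Formula ℕ)) (φ : L.Formula ℕ) : Prop :=
  ∃ ψ : L.Formula ℕ, IsBooleanCombination S ψ ∧ φ ⇔[T] ψ

/-- `φ` is an `n`-formula of `T`: it is `T`-equivalent to a Boolean combination of formulas,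
each of the form `θ(x₁, …, xₙ)`, that is, with free variables among `n` variables. The first-order
variables are indexed by `ℕ`. -/
def IsNFormula (T : L.Theory) (n : ℕ) (φ : L.Formula ℕ) : Prop :=
  IsBasedOn T {θ : L.Formula ℕ | θ.freeVarFinset.card ≤ n} φ

/-- The formulas obtained from members of `Φ` by substituting variables (not necessarily distinct)
for the free variables. -/
def substitutions (Φ : Set (L.Formula ℕ)) : Set (L.Formula ℕ) :=
  {θ : L.Formula ℕ | ∃ φ ∈ Φ, ∃ σ : ℕ → ℕ, θ = Formula.relabel σ φ}

/-- The formulas in `Φ` witness that `T` is almost `n`-ary. -/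
def WitnessAlmostAry (T : L.Theory) (n : ℕ) (Φ : Set (L.Formula ℕ)) : Prop :=
  ∀ φ : L.Formula ℕ, IsBasedOn T ({θ | IsNFormula T n θ} ∪ substitutions Φ) φ

/-- `T` is almost `n`-ary: finitely many formulas witness this. -/
def AlmostAry (T : L.Theory) (n : ℕ) : Prop :=
  ∃ Φ : Set (L.Formula ℕ), Φ.Finite ∧ WitnessAlmostAry T n Φ

/-- `aar T` is the least `n ≥ 1` such that `T` is almost `n`-ary, and `∞` if there is none. -/
noncomputable def aar (T : L.Theory) : ℕ∞ :=
  sInf {a : ℕ∞ | ∃ n : ℕ, 1 ≤ n ∧ AlmostAry T n ∧ a = n}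

end AlmostArity

open FirstOrder FirstOrder.Language Cardinal

/-! ### Completeness, compactness and countable models. -/

namespace FirstOrder.Language

variable {L : FirstOrder.Language.{u, v}} {T : L.Theory}

/-! By Ryll-Nardzewski, there are only finitely many formulas in `n` variables up to
`T`-equivalence. Hence every formula with at most `n` free variables is, up to equivalence, a
substitution instance of one of finitely many representatives. Adding these to the witnesses of
almost `n`-arity makes the `n`-formulas superfluous, so the arity bound no longer matters.

For Ryll-Nardzewski, suppose a model has infinitely many definable sets of tuples. Then some
non-isolated type is realised in one countable model (`exists_realize_nonisolated`) and omitted in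
another (`exists_model_omitting`), contradicting categoricity. -/

theorem Formula.exists_realize_iff_realize_exClosure {α : Type*} [DecidableEq α] (φ : L.Formula α)
    (M : Type*) [L.Structure M] [Nonempty M] :
    (∃ v : α → M, φ.Realize v) ↔ M ⊨ φ.exClosure := by
  rw [← Formula.exists_realize_equivSentence_iff_realize_exClosure]
  refine exists_congr fun v => ?_
  rw [← Formula.realize_equivSentence_symm, _root_.Equiv.symm_apply_apply]

/-- Satisfiability of a formula does not depend on the model of a complete theory. -/
theorem Theory.IsComplete.exists_realize_iff (hT : T.IsComplete) {α : Type*} (φ : L.Formula α)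
    (M N : Type*) [L.Structure M] [L.Structure N] [M ⊨ T] [N ⊨ T] [Nonempty M] [Nonempty N] :
    (∃ v : α → M, φ.Realize v) ↔ ∃ v : α → N, φ.Realize v := by
  classical
  rw [φ.exists_realize_iff_realize_exClosure M, φ.exists_realize_iff_realize_exClosure N,
    hT.realize_sentence_iff, hT.realize_sentence_iff]

/-- Validity of a formula does not depend on the model of a complete theory. -/
theorem Theory.IsComplete.forall_realize_iff (hT : T.IsComplete) {α : Type*} (φ : L.Formula α)
    (M N : Type*) [L.Structure M] [L.Structure N] [M ⊨ T] [N ⊨ T] [Nonempty M] [Nonempty N] :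
    (∀ v : α → M, φ.Realize v) ↔ ∀ v : α → N, φ.Realize v := by
  have := (hT.exists_realize_iff φ.not M N).not
  simpa [Formula.realize_not] using this

/-- Equivalence modulo a complete theory can be tested in a single model. -/
theorem Theory.IsComplete.iff_of_realize (hT : T.IsComplete) {α : Type*} {φ ψ : L.Formula α}
    (M : Type*) [L.Structure M] [M ⊨ T] [Nonempty M]
    (h : ∀ v : α → M, φ.Realize v ↔ ψ.Realize v) : φ ⇔[T] ψ := by
  refine Theory.models_formula_iff.2 fun N => ?_
  refine (hT.forall_realize_iff (BoundedFormula.iff φ ψ : L.Formula α) M N).1 fun v => ?_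
  exact Formula.realize_iff.2 (h v)

theorem Theory.IsComplete.infinite (hT : T.IsComplete) (M N : Type*) [L.Structure M]
    [L.Structure N] [M ⊨ T] [N ⊨ T] [Nonempty M] [Nonempty N] [Infinite M] : Infinite N :=
  (hT.models_elementarily_equivalent M N).infinite_iff.1 inferInstance

/-- Compactness combined with the downward Löwenheim–Skolem theorem: a set of formulas each finite
part of which is realised in an infinite model is realised in a countably infinite model. -/
theorem Theory.exists_model_aleph0_realize (hL : L.card ≤ ℵ₀) (hT : T.IsComplete) {α : Type}
    [Countable α] (M : Type*) [L.Structure M] [M ⊨ T] [Nonempty M] [Infinite M]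
    (S : Set (L.Formula α))
    (hS : ∀ S₀ : Set (L.Formula α), S₀ ⊆ S → S₀.Finite → ∃ v : α → M, ∀ φ ∈ S₀, φ.Realize v) :
    ∃ N : Theory.ModelType.{u, v, w} T, #N = ℵ₀ ∧ ∃ v : α → N, ∀ φ ∈ S, φ.Realize v := by
  classical
  -- Variables become new constants, so that compactness for sentences applies.
  have hsat : ((L.lhomWithConstants α).onTheory T ∪ Formula.equivSentence '' S).IsSatisfiable := by
    rw [Theory.isSatisfiable_iff_isFinitelySatisfiable]
    intro T₀ hT₀
    obtain ⟨v, hv⟩ := hS {φ | φ ∈ S ∧ Formula.equivSentence φ ∈ T₀} (fun φ h => h.1)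
      (((T₀ : Set L[[α]].Sentence).toFinite.preimage
        Formula.equivSentence.injective.injOn).subset fun φ h => h.2)
    let : (constantsOn α).Structure M := constantsOn.structure v
    have : M ⊨ (T₀ : L[[α]].Theory) := by
      refine ⟨fun φ hφ => ?_⟩
      rcases hT₀ hφ with h | ⟨ψ, hψ, rfl⟩
      · exact ((LHom.onTheory_model (L.lhomWithConstants α) T).2
          inferInstance).realize_of_mem φ h
      · exact (Formula.realize_equivSentence _ _).2 (hv ψ ⟨hψ, hφ⟩)
    exact Theory.Model.isSatisfiable M
  obtain ⟨N⟩ := hsat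
  let N₀ : T.ModelType := (N.subtheoryModel Set.subset_union_left).reduct (L.lhomWithConstants α)
  let v₀ : α → N₀ := fun a => (L.con a : N)
  have hv₀ : ∀ φ ∈ S, φ.Realize v₀ := by
    intro φ hφ
    have h1 : N ⊨ Formula.equivSentence φ :=
      N.is_model.realize_of_mem _ (Or.inr ⟨φ, hφ, rfl⟩)
    let := (L.lhomWithConstants α).reduct N
    exact (Formula.realize_equivSentence N φ).1 h1
  have : Infinite N₀ := hT.infinite M N₀
  obtain ⟨E, hE, hcard⟩ := exists_elementarySubstructure_card_eq (L := L) (M := N₀) (Set.range v₀)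
    (ℵ₀ : Cardinal.{w}) le_rfl
    (by rw [lift_aleph0, lift_le_aleph0, mk_le_aleph0_iff]
        exact (Set.countable_range v₀).to_subtype)
    (by simpa using hL) (by simp)
  have hcard' : #E = ℵ₀ := by simpa using hcard
  have : Countable E := mk_le_aleph0_iff.1 hcard'.le
  have : Infinite E := infinite_iff.2 hcard'.ge
  -- Copying onto `ULift ℕ` puts the model in universe `w`, where categoricity is assumed.
  obtain ⟨e⟩ : Nonempty (E ≃ ULift.{w} ℕ) := nonempty_equiv_of_countable
  have : (E : Type _) ⊨ T := (E.theory_model_iff T).2 inferInstance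
  let K : Theory.ModelType.{u, v, w} T :=
    Theory.ModelType.equivInduced (M := Theory.ModelType.of T E) e
  let f : E ≃[L] K := @Equiv.inducedStructureEquiv L E (ULift.{w} ℕ) _ e
  refine ⟨K, ?_, fun a => f ⟨v₀ a, hE ⟨a, rfl⟩⟩, fun φ hφ => ?_⟩
  · have : #(ULift.{w} ℕ) = ℵ₀ := by simp
    exact this
  · have h1 := (E.subtype.map_formula φ fun a => ⟨v₀ a, hE ⟨a, rfl⟩⟩).1 (hv₀ φ hφ)
    exact (StrongHomClass.realize_formula f φ).2 h1

/-! ### Small definable sets and non-isolated types. -/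

section FinitelyManyBelow

variable (L) {α M : Type*} [L.Structure M]

/-- Only finitely many `∅`-definable sets are contained in `D`. -/
def FinitelyManyDefinableBelow (D : Set (α → M)) : Prop :=
  {E : Set (α → M) | (∅ : Set M).Definable L E ∧ E ⊆ D}.Finite

variable {L}

theorem FinitelyManyDefinableBelow.union {D₁ D₂ : Set (α → M)}
    (hD₁ : (∅ : Set M).Definable L D₁) (hD₂ : (∅ : Set M).Definable L D₂)
    (h₁ : FinitelyManyDefinableBelow L D₁) (h₂ : FinitelyManyDefinableBelow L D₂) :
    FinitelyManyDefinableBelow L (D₁ ∪ D₂) := by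
  refine (Set.Finite.image2 (· ∪ ·) h₁ h₂).subset ?_
  rintro E ⟨hE, hsub⟩
  refine ⟨E ∩ D₁, ⟨hE.inter hD₁, Set.inter_subset_right⟩, E ∩ D₂,
    ⟨hE.inter hD₂, Set.inter_subset_right⟩, ?_⟩
  change E ∩ D₁ ∪ E ∩ D₂ = E
  rw [← Set.inter_union_distrib_left, Set.inter_eq_left.2 hsub]

theorem FinitelyManyDefinableBelow.setOf_exists_realize {S : Set (L.Formula α)} (hS : S.Finite)
    (h : ∀ φ ∈ S, FinitelyManyDefinableBelow L ({v : α → M | φ.Realize v})) :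
    (∅ : Set M).Definable L {v : α → M | ∃ φ ∈ S, φ.Realize v} ∧
      FinitelyManyDefinableBelow L {v : α → M | ∃ φ ∈ S, φ.Realize v} := by
  induction S, hS using Set.Finite.induction_on with
  | empty =>
    simp only [Set.mem_empty_iff_false, false_and, exists_false, Set.ofPred_false]
    refine ⟨Set.definable_empty, (Set.finite_singleton ∅).subset ?_⟩
    rintro E ⟨-, hE⟩
    exact Set.subset_empty_iff.1 hE
  | @insert φ S _ _ ih =>
    have heq : {v : α → M | ∃ ψ ∈ insert φ S, ψ.Realize v} =
        {v : α → M | φ.Realize v} ∪ {v : α → M | ∃ ψ ∈ S, ψ.Realize v} := by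
      ext v; simp
    have hφ : (∅ : Set M).Definable L ({v : α → M | φ.Realize v}) :=
      Set.empty_definable_iff.2 ⟨φ, rfl⟩
    have ih' := ih fun ψ hψ => h ψ (Set.mem_insert_of_mem _ hψ)
    rw [heq]
    exact ⟨hφ.union ih'.1, .union hφ ih'.1 (h φ (Set.mem_insert _ _)) ih'.2⟩

/-- A set that contains infinitely many definable sets is split by one of them. -/
theorem exists_definable_split {D : Set (α → M)} (h : ¬ FinitelyManyDefinableBelow L D) :
    ∃ E : Set (α → M), (∅ : Set M).Definable L E ∧ (D ∩ E).Nonempty ∧ (D \ E).Nonempty := by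
  by_contra! hcon
  refine h (((Set.finite_singleton D).insert ∅).subset ?_)
  rintro E ⟨hE, hsub⟩
  rcases Set.eq_empty_or_nonempty E with rfl | hne
  · simp
  · right
    have := hcon E hE (by rwa [Set.inter_eq_right.2 hsub])
    exact hsub.antisymm (Set.sdiff_eq_empty.1 this)

end FinitelyManyBelow

/-- If an infinite model of a complete theory has infinitely many definable sets of `n`-tuples, then
a non-isolated type in `n` variables is realised in a countable model. -/
theorem Theory.exists_realize_nonisolated (hL : L.card ≤ ℵ₀) (hT : T.IsComplete) {α : Type}
    [Countable α] (M : Type*) [L.Structure M] [M ⊨ T] [Nonempty M] [Infinite M]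
    (hinf : ¬ {D : Set (α → M) | (∅ : Set M).Definable L D}.Finite) :
    ∃ N : Theory.ModelType.{u, v, w} T, #N = ℵ₀ ∧ ∃ b : α → N, ∀ φ : L.Formula α,
      (∃ v : α → M, φ.Realize v) →
        ∃ σ : L.Formula α, σ.Realize b ∧ ∃ v : α → M, φ.Realize v ∧ ¬ σ.Realize v := by
  -- Finitely many small sets cannot cover all tuples, since small sets are closed under finite
  -- unions. So some `b` satisfies no small formula.
  obtain ⟨N, hN, b, hb⟩ := Theory.exists_model_aleph0_realize.{u, v, w} hL hT M
    (Formula.not '' {φ : L.Formula α |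
      FinitelyManyDefinableBelow L ({v : α → M | φ.Realize v})}) (by
    intro S₀ hS₀ hfin
    obtain ⟨S, hS, hSfin, rfl⟩ := Set.exists_subset_image_finite_and.1 ⟨S₀, hS₀, hfin, rfl⟩
    have hsmall := (FinitelyManyDefinableBelow.setOf_exists_realize hSfin hS).2
    by_contra! hcon
    refine hinf (hsmall.subset fun E hE => ⟨hE, fun v _ => ?_⟩)
    obtain ⟨_, ⟨φ, hφ, rfl⟩, h⟩ := hcon v
    exact ⟨φ, hφ, by simpa [Formula.realize_not] using h⟩)
  refine ⟨N, hN, b, fun φ hφ => ?_⟩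
  by_cases hφb : φ.Realize b
  · have hns : ¬ FinitelyManyDefinableBelow L ({v : α → M | φ.Realize v}) := fun hs =>
      Formula.realize_not.1 (hb _ ⟨φ, hs, rfl⟩) hφb
    -- Whichever side of the split the type of `b` selects, `φ` has a solution on the other side.
    obtain ⟨E, hE, ⟨x, hxφ, hxE⟩, ⟨y, hyφ, hyE⟩⟩ := exists_definable_split hns
    obtain ⟨ψ, rfl⟩ := Set.empty_definable_iff.1 hE
    by_cases hψ : ψ.Realize b
    · exact ⟨ψ, hψ, y, hyφ, hyE⟩
    · exact ⟨ψ.not, Formula.realize_not.2 hψ, x, hxφ, fun h => Formula.realize_not.1 h hxE⟩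
  · obtain ⟨v, hv⟩ := hφ
    exact ⟨φ.not, Formula.realize_not.2 hφb, v, hv, fun h => Formula.realize_not.1 h hv⟩

/-! ### Omitting types by a generic Henkin construction. -/

theorem Formula.realize_congr_freeVar {α M : Type*} [DecidableEq α] [L.Structure M]
    (φ : L.Formula α) {v w : α → M} (h : ∀ a ∈ φ.freeVarFinset, v a = w a) :
    φ.Realize v ↔ φ.Realize w := by
  have h₁ := BoundedFormula.realize_restrictFreeVar (φ := φ) (f := fun a => (a : α)) (v := v)
    (xs := default) v fun _ => rfl
  have h₂ := BoundedFormula.realize_restrictFreeVar (φ := φ) (f := fun a => (a : α)) (v := v)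
    (xs := default) w fun a => h a a.2
  exact h₁.symm.trans h₂

/-- The formulas in countably many variables that are satisfiable in `M`, preordered by
reverse implication. -/
def SatFormula (L : FirstOrder.Language.{u, v}) (M : Type*) [L.Structure M] : Type _ :=
  {θ : L.Formula ℕ // ∃ v : ℕ → M, θ.Realize v}

instance (M : Type*) [L.Structure M] : Preorder (SatFormula L M) where
  le θ θ' := ∀ v : ℕ → M, θ'.1.Realize v → θ.1.Realize v
  le_refl _ _ h := h
  le_trans _ _ _ h h' v hv := h v (h' v hv)

/-- The conditions that decide the existence of a solution of `φ`, naming a witness if there is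
one. -/
def henkinCofinal (M : Type*) [L.Structure M] (φ : L.Formula (ℕ ⊕ Fin 1)) :
    Order.Cofinal (SatFormula L M) where
  carrier := {θ | (∀ v : ℕ → M, θ.1.Realize v → ∀ x, ¬ φ.Realize (Sum.elim v x)) ∨
    ∃ i : ℕ, ∀ v : ℕ → M, θ.1.Realize v → φ.Realize (Sum.elim v fun _ => v i)}
  isCofinal := by
    classical
    rintro ⟨θ, v₀, hv₀⟩
    by_cases h : ∀ v : ℕ → M, θ.Realize v → ∀ x, ¬ φ.Realize (Sum.elim v x)
    · exact ⟨⟨θ, v₀, hv₀⟩, Or.inl h, le_rfl⟩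
    · push Not at h
      obtain ⟨v, hv, x, hx⟩ := h
      -- A variable free in neither formula can be reassigned to name the witness.
      obtain ⟨i, hi⟩ := Infinite.exists_notMem_finset (θ.freeVarFinset ∪ φ.freeVarFinset.toLeft)
      have hiθ : i ∉ θ.freeVarFinset := fun h => hi (Finset.mem_union_left _ h)
      have hiφ : Sum.inl i ∉ φ.freeVarFinset := fun h =>
        hi (Finset.mem_union_right _ (Finset.mem_toLeft.2 h))
      refine ⟨⟨θ ⊓ φ.relabel (Sum.elim id fun _ => i), Function.update v i (x 0), ?_⟩,
        Or.inr ⟨i, fun w hw => ?_⟩, fun w hw => ?_⟩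
      · rw [Formula.realize_inf, Formula.realize_relabel]
        constructor
        · refine (Formula.realize_congr_freeVar θ fun a ha => ?_).2 hv
          exact Function.update_of_ne (by rintro rfl; exact hiθ ha) _ _
        · refine (Formula.realize_congr_freeVar φ fun a ha => ?_).2 hx
          rcases a with a | a
          · exact Function.update_of_ne (fun h : a = i => by subst h; exact hiφ ha) _ _
          · simp [Subsingleton.elim a 0]
      · have := (Formula.realize_inf.1 hw).2
        rw [Formula.realize_relabel] at this
        convert this using 1
        ext (a | a) <;> rfl
      · exact (Formula.realize_inf.1 hw).1

/-- The tuples induced by solutions of a formula in infinitely many variables are defined by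
a formula. -/
theorem Formula.exists_formula_image_comp {α β M : Type*} [Finite β] [L.Structure M] [Nonempty M]
    (θ : L.Formula α) (s : β → α) :
    ∃ φ : L.Formula β, ∀ w : β → M, φ.Realize w ↔ ∃ v : α → M, θ.Realize v ∧ v ∘ s = w := by
  classical
  cases nonempty_fintype β
  -- Only these finitely many coordinates matter, and projections between finite powers preserve
  -- definability.
  let F : Finset α := θ.freeVarFinset ∪ Finset.univ.image s
  let ι : θ.freeVarFinset → F := fun a => ⟨a, Finset.mem_union_left _ a.2⟩
  let s' : β → F := fun b =>
    ⟨s b, Finset.mem_union_right _ (Finset.mem_image_of_mem s (Finset.mem_univ b))⟩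
  have hD : (∅ : Set M).Definable L
      {u : F → M | Formula.Realize (BoundedFormula.restrictFreeVar θ ι) u} :=
    Set.empty_definable_iff.2 ⟨_, rfl⟩
  obtain ⟨φ, hφ⟩ := Set.empty_definable_iff.1 (hD.image_comp s')
  have hres : ∀ v : α → M,
      Formula.Realize (BoundedFormula.restrictFreeVar θ ι) (fun a : F => v a) ↔ θ.Realize v :=
    fun v => BoundedFormula.realize_restrictFreeVar v fun _ => rfl
  refine ⟨φ, fun w => ?_⟩
  have hw : φ.Realize w ↔ w ∈ (fun g : F → M => g ∘ s') ''
      {u : F → M | Formula.Realize (BoundedFormula.restrictFreeVar θ ι) u} := by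
    rw [hφ]; rfl
  rw [hw]
  constructor
  · rintro ⟨u, hu, rfl⟩
    let v : α → M := fun a => if h : a ∈ F then u ⟨a, h⟩ else Classical.arbitrary M
    have hv : (fun a : F => v a) = u := by
      ext a; simp [v]
    refine ⟨v, (hres v).1 (by rw [hv]; exact hu), ?_⟩
    rw [← hv]; rfl
  · rintro ⟨v, hv, rfl⟩
    exact ⟨fun a : F => v a, (hres v).2 hv, rfl⟩

/-- The conditions that force some formula of `p` to fail at the variables listed by `s`. -/
def omitCofinal {M β : Type*} [Finite β] [L.Structure M] [Nonempty M] (p : Set (L.Formula β))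
    (hp : ∀ φ : L.Formula β, (∃ v : β → M, φ.Realize v) →
      ∃ σ ∈ p, ∃ v : β → M, φ.Realize v ∧ ¬ σ.Realize v) (s : β → ℕ) :
    Order.Cofinal (SatFormula L M) where
  carrier := {θ | ∃ σ ∈ p, ∀ v : ℕ → M, θ.1.Realize v → ¬ σ.Realize (v ∘ s)}
  isCofinal := by
    rintro ⟨θ, v₀, hv₀⟩
    obtain ⟨φ, hφ⟩ := Formula.exists_formula_image_comp (M := M) θ s
    obtain ⟨σ, hσ, w, hw, hσw⟩ := hp φ ⟨v₀ ∘ s, (hφ _).2 ⟨v₀, hv₀, rfl⟩⟩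
    obtain ⟨v, hv, rfl⟩ := (hφ w).1 hw
    refine ⟨⟨θ ⊓ (σ.relabel s).not, v, ?_⟩, ⟨σ, hσ, fun u hu => ?_⟩, fun u hu => ?_⟩
    · rw [Formula.realize_inf, Formula.realize_not, Formula.realize_relabel]
      exact ⟨hv, hσw⟩
    · have := (Formula.realize_inf.1 hu).2
      rwa [Formula.realize_not, Formula.realize_relabel] at this
    · exact (Formula.realize_inf.1 hu).1

theorem Theory.IsComplete.not_realize_of_forall (hT : T.IsComplete) {α : Type*} {M N : Type*}
    [L.Structure M] [L.Structure N] [M ⊨ T] [N ⊨ T] [Nonempty M] [Nonempty N] {θ φ : L.Formula α}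
    (h : ∀ v : α → M, θ.Realize v → ¬ φ.Realize v) {v : α → N} (hθ : θ.Realize v) :
    ¬ φ.Realize v := fun hφ => by
  obtain ⟨u, hu⟩ := (hT.exists_realize_iff (θ ⊓ φ) N M).1 ⟨v, Formula.realize_inf.2 ⟨hθ, hφ⟩⟩
  exact h u (Formula.realize_inf.1 hu).1 (Formula.realize_inf.1 hu).2

theorem Theory.IsComplete.realize_of_forall (hT : T.IsComplete) {α : Type*} {M N : Type*}
    [L.Structure M] [L.Structure N] [M ⊨ T] [N ⊨ T] [Nonempty M] [Nonempty N] {θ φ : L.Formula α}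
    (h : ∀ v : α → M, θ.Realize v → φ.Realize v) {v : α → N} (hθ : θ.Realize v) :
    φ.Realize v := by
  by_contra hφ
  exact hT.not_realize_of_forall (φ := φ.not)
    (fun u hu hn => Formula.realize_not.1 hn (h u hu)) hθ (Formula.realize_not.2 hφ)

/-- The **omitting types theorem** for one type over a complete theory with infinite models. -/
theorem Theory.exists_model_omitting (hL : L.card ≤ ℵ₀) (hT : T.IsComplete) {β : Type} [Finite β]
    (M : Type*) [L.Structure M] [M ⊨ T] [Nonempty M] [Infinite M] (p : Set (L.Formula β))
    (hp : ∀ φ : L.Formula β, (∃ v : β → M, φ.Realize v) →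
      ∃ σ ∈ p, ∃ v : β → M, φ.Realize v ∧ ¬ σ.Realize v) :
    ∃ N : Theory.ModelType.{u, v, w} T, #N = ℵ₀ ∧ ∀ w : β → N, ∃ σ ∈ p, ¬ σ.Realize w := by
  classical
  have : Countable L.Symbols := mk_le_aleph0_iff.1 hL
  have := Encodable.ofCountable (L.Formula (ℕ ⊕ Fin 1))
  have := Encodable.ofCountable (β → ℕ)
  -- There are countably many requirements, so one ideal meets them all.
  let 𝒟 : L.Formula (ℕ ⊕ Fin 1) ⊕ (β → ℕ) → Order.Cofinal (SatFormula L M) :=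
    Sum.elim (henkinCofinal M) (omitCofinal p hp)
  let θ₀ : SatFormula L M := ⟨⊤, fun _ => Classical.arbitrary M, Formula.realize_top.2 trivial⟩
  let G := Order.idealOfCofinals θ₀ 𝒟
  obtain ⟨N, hN, a, ha⟩ := Theory.exists_model_aleph0_realize.{u, v, w} hL hT M
    ((fun θ : SatFormula L M => θ.1) '' (G : Set (SatFormula L M))) (by
    intro S₀ hS₀ hfin
    obtain ⟨S, hS, hSfin, rfl⟩ := Set.exists_subset_image_finite_and.1 ⟨S₀, hS₀, hfin, rfl⟩
    have hub : ∃ θ ∈ G, ∀ η ∈ S, η ≤ θ := by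
      clear hfin hS₀
      induction S, hSfin using Set.Finite.induction_on with
      | empty => exact ⟨θ₀, Order.mem_idealOfCofinals _ _, by simp⟩
      | @insert η S _ _ ih =>
        obtain ⟨θ, hθ, hθS⟩ := ih fun η hη => hS (Set.mem_insert_of_mem _ hη)
        obtain ⟨ζ, hζ, h₁, h₂⟩ := G.directed η (hS (Set.mem_insert _ _)) θ hθ
        refine ⟨ζ, hζ, ?_⟩
        rintro ξ (rfl | hξ)
        · exact h₁
        · exact (hθS ξ hξ).trans h₂
    obtain ⟨⟨θ, v, hv⟩, -, hθ⟩ := hub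
    refine ⟨v, ?_⟩
    rintro _ ⟨η, hη, rfl⟩
    exact hθ η hη v hv)
  -- Tarski–Vaught test: the Henkin conditions make the range of `a` an elementary substructure.
  have hmeets : L.MeetsDefinable (Set.range a) := by
    rintro D ⟨d, hd⟩ hD
    obtain ⟨φ, hφ⟩ := Set.definable_iff_exists_formula_sum.1 hD
    have hDφ : ∀ x : N, x ∈ D ↔ φ.Realize (Sum.elim (↑) fun _ => x) :=
      fun x => Set.ext_iff.1 hφ fun _ => x
    -- Parameters are replaced by indices naming them, turning the definition of `D` into a Henkin
    -- requirement.
    let r : Set.range a → ℕ := fun y => y.2.choose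
    have hr : ∀ y, a (r y) = y := fun y => y.2.choose_spec
    let φ' : L.Formula (ℕ ⊕ Fin 1) := φ.relabel (Sum.map r id)
    have hφ' : ∀ x : N, φ'.Realize (Sum.elim a fun _ => x) ↔ x ∈ D := fun x => by
      rw [hDφ, Formula.realize_relabel]
      have : Sum.elim a (fun _ => x) ∘ Sum.map r id =
          (Sum.elim (↑) fun _ => x : Set.range a ⊕ Fin 1 → N) := by
        ext (y | y)
        · exact hr y
        · rfl
      rw [this]
    obtain ⟨θ, hθ, hθG⟩ := Order.cofinal_meets_idealOfCofinals θ₀ 𝒟 (Sum.inl φ')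
    have hθa : θ.1.Realize a := ha _ ⟨θ, hθG, rfl⟩
    rcases hθ with hθ | ⟨i, hθ⟩
    · exfalso
      refine hT.not_realize_of_forall (M := M) (θ := θ.1.relabel Sum.inl) (φ := φ')
        (v := Sum.elim a fun _ => d) (fun v hv => ?_) ?_ ((hφ' d).2 hd)
      · rw [← Sum.elim_comp_inl_inr v]
        exact hθ _ (Formula.realize_relabel.1 hv) _
      · rw [Formula.realize_relabel]; exact hθa
    · refine ⟨a i, (hφ' _).1 ?_, i, rfl⟩
      have h := hT.realize_of_forall (M := M) (φ := φ'.relabel (Sum.elim id fun _ => i))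
        (fun v hv => ?_) hθa
      · rw [Formula.realize_relabel] at h
        convert h using 1
        ext (y | y) <;> rfl
      · rw [Formula.realize_relabel]
        convert hθ v hv using 1
        ext (y | y) <;> rfl
  let E : L.ElementarySubstructure N := hmeets.toElementarySubstructure
  have hE : (E : Set N) = Set.range a := hmeets.closure_eq_self
  have : (E : Type _) ⊨ T := (E.theory_model_iff T).2 inferInstance
  have : Infinite E := hT.infinite M E
  have : Countable E := by
    have : Countable (E : Set N) := by
      rw [hE]; exact (Set.countable_range a).to_subtype
    exact this
  refine ⟨Theory.ModelType.of T E, mk_eq_aleph0 E, fun w => ?_⟩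
  have hw : ∀ b, ∃ i, a i = (w b : E).1 := fun b => by
    have : (w b : E).1 ∈ (E : Set N) := (w b : E).2
    rwa [hE] at this
  choose s hs using hw
  obtain ⟨θ, ⟨σ, hσ, hθ⟩, hθG⟩ := Order.cofinal_meets_idealOfCofinals θ₀ 𝒟 (Sum.inr s)
  refine ⟨σ, hσ, fun h => ?_⟩
  have h' : σ.Realize (a ∘ s) := by
    have := (E.subtype.map_formula σ w).2 h
    convert this using 1
    ext b
    exact hs b
  refine hT.not_realize_of_forall (M := M) (φ := σ.relabel s) (fun v hv hn => ?_)
    (ha _ ⟨θ, hθG, rfl⟩) (Formula.realize_relabel.2 h')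
  exact hθ v hv (Formula.realize_relabel.1 hn)

/-- One direction of the **Ryll-Nardzewski theorem**: a model of an `ω`-categorical complete theory
has only finitely many definable sets of `n`-tuples. -/
theorem Theory.finite_definable_of_categorical (hL : L.card ≤ ℵ₀) (hT : T.IsComplete)
    (hcat : (ℵ₀ : Cardinal.{w}).Categorical T) {β : Type} [Finite β] (M : Type*) [L.Structure M]
    [M ⊨ T] [Nonempty M] : {D : Set (β → M) | (∅ : Set M).Definable L D}.Finite := by
  cases finite_or_infinite M
  · exact Set.toFinite _
  by_contra hinf
  obtain ⟨N, hN, b, hb⟩ := Theory.exists_realize_nonisolated.{u, v, w} hL hT M hinf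
  obtain ⟨N', hN', hom⟩ := Theory.exists_model_omitting.{u, v, w} hL hT M
    {σ : L.Formula β | σ.Realize b} hb
  obtain ⟨f⟩ := hcat N N' hN hN'
  obtain ⟨σ, hσ, hn⟩ := hom (f ∘ b)
  exact hn ((StrongHomClass.realize_formula f σ).2 hσ)

end FirstOrder.Language

/-! ### Boolean combinations, substitutions and arity. -/

namespace AlmostArity

variable {L : FirstOrder.Language.{u, v}}

theorem IsBasedOn.of_iff {T : L.Theory} {S : Set (L.Formula ℕ)} {φ ψ : L.Formula ℕ}
    (h : IsBasedOn T S ψ) (hφ : φ ⇔[T] ψ) : IsBasedOn T S φ := by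
  obtain ⟨χ, hχ, hψ⟩ := h
  exact ⟨χ, hχ, hφ.trans hψ⟩

theorem iff_of_forall_realize {T : L.Theory} {φ ψ : L.Formula ℕ}
    (h : ∀ (M : Theory.ModelType.{u, v, max u v} T) (v : ℕ → M), φ.Realize v ↔ ψ.Realize v) :
    φ ⇔[T] ψ :=
  Theory.models_formula_iff.2 fun M v => Formula.realize_iff.2 (h M v)

theorem IsBooleanCombination.isBasedOn {T : L.Theory} {S S' : Set (L.Formula ℕ)}
    (hS : ∀ θ ∈ S, IsBasedOn T S' θ) {φ : L.Formula ℕ} (h : IsBooleanCombination S φ) :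
    IsBasedOn T S' φ := by
  induction h with
  | of h => exact hS _ h
  | falsum => exact ⟨⊥, .falsum, Theory.Iff.refl _⟩
  | neg _ ih =>
    obtain ⟨χ, hχ, h⟩ := ih
    exact ⟨χ.not, hχ.neg, h.not⟩
  | conj _ _ ih₁ ih₂ =>
    obtain ⟨χ₁, hχ₁, h₁⟩ := ih₁
    obtain ⟨χ₂, hχ₂, h₂⟩ := ih₂
    refine ⟨χ₁ ⊓ χ₂, hχ₁.conj hχ₂, iff_of_forall_realize fun M v => ?_⟩
    rw [Formula.realize_inf, Formula.realize_inf, h₁.realize_iff, h₂.realize_iff]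
  | disj _ _ ih₁ ih₂ =>
    obtain ⟨χ₁, hχ₁, h₁⟩ := ih₁
    obtain ⟨χ₂, hχ₂, h₂⟩ := ih₂
    refine ⟨χ₁ ⊔ χ₂, hχ₁.disj hχ₂, iff_of_forall_realize fun M v => ?_⟩
    rw [Formula.realize_sup, Formula.realize_sup, h₁.realize_iff, h₂.realize_iff]

theorem IsBasedOn.trans {T : L.Theory} {S S' : Set (L.Formula ℕ)}
    (hS : ∀ θ ∈ S, IsBasedOn T S' θ) {φ : L.Formula ℕ} (h : IsBasedOn T S φ) :
    IsBasedOn T S' φ := by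
  obtain ⟨χ, hχ, h⟩ := h
  exact (hχ.isBasedOn hS).of_iff h

/-- If every formula in `n` variables is equivalent to a member of `R`, then every formula with at
most `n` free variables is obtained, up to equivalence, from a member of `R` by substituting
variables. -/
theorem isBasedOn_substitutions {T : L.Theory} (n : ℕ) {R : Set (L.Formula (Fin n))}
    (hR : ∀ φ : L.Formula (Fin n), ∃ ρ ∈ R, φ ⇔[T] ρ) {θ : L.Formula ℕ}
    (hθ : θ.freeVarFinset.card ≤ n) :
    IsBasedOn T (substitutions (Formula.relabel (Fin.val : Fin n → ℕ) '' R)) θ := by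
  let e : θ.freeVarFinset → Fin n := Fin.castLE hθ ∘ θ.freeVarFinset.equivFin
  have he : Function.Injective e :=
    (Fin.castLE_injective hθ).comp θ.freeVarFinset.equivFin.injective
  -- `σ` undoes the numbering `e` of the free variables; its values elsewhere are irrelevant.
  let σ : ℕ → ℕ := Function.extend (Fin.val ∘ e) Subtype.val id
  have hσ : ∀ a, σ (e a) = a := fun a =>
    (Fin.val_injective.comp he).extend_apply Subtype.val id a
  obtain ⟨ρ, hρ, hiff⟩ := hR (BoundedFormula.restrictFreeVar θ e)
  refine ⟨(ρ.relabel Fin.val).relabel σ, .of ⟨_, ⟨ρ, hρ, rfl⟩, σ, rfl⟩,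
    iff_of_forall_realize fun M v => ?_⟩
  rw [Formula.realize_relabel, Formula.realize_relabel, ← hiff.realize_iff]
  exact (BoundedFormula.realize_restrictFreeVar (v := (v ∘ σ) ∘ Fin.val) v
    fun a => congrArg v (hσ a)).symm

theorem substitutions_mono {Φ Ψ : Set (L.Formula ℕ)} (h : Φ ⊆ Ψ) :
    substitutions Φ ⊆ substitutions Ψ := by
  rintro _ ⟨φ, hφ, σ, rfl⟩
  exact ⟨φ, h hφ, σ, rfl⟩

/-- One formula per definable set of a single model suffices, because completeness transfers
equivalence from that model to `T`. -/
theorem exists_finite_representatives (hL : L.card ≤ ℵ₀) {T : L.Theory} (hT : T.IsComplete)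
    (hcat : (ℵ₀ : Cardinal.{w}).Categorical T) (n : ℕ) :
    ∃ R : Set (L.Formula (Fin n)), R.Finite ∧ ∀ φ : L.Formula (Fin n), ∃ ρ ∈ R, φ ⇔[T] ρ := by
  obtain ⟨M⟩ := hT.1
  have hfin := Theory.finite_definable_of_categorical.{u, v, w} (β := Fin n) hL hT hcat M
  choose g hg using fun D : {D : Set (Fin n → M) | (∅ : Set M).Definable L D} =>
    Set.empty_definable_iff.1 D.2
  have := hfin.to_subtype
  refine ⟨Set.range g, Set.finite_range g, fun φ => ?_⟩
  let D : {D : Set (Fin n → M) | (∅ : Set M).Definable L D} :=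
    ⟨{v | φ.Realize v}, Set.empty_definable_iff.2 ⟨φ, rfl⟩⟩
  exact ⟨g D, ⟨D, rfl⟩, hT.iff_of_realize M fun v => Set.ext_iff.1 (hg D) v⟩

/-- An `ω`-categorical almost `n`-ary theory is almost `k`-ary for every `k`. -/
theorem AlmostAry.of_categorical (hL : L.card ≤ ℵ₀) {T : L.Theory} (hT : T.IsComplete)
    (hcat : (ℵ₀ : Cardinal.{w}).Categorical T) {n : ℕ} (hn : AlmostAry T n) (k : ℕ) :
    AlmostAry T k := by
  obtain ⟨Φ, hΦ, hw⟩ := hn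
  obtain ⟨R, hRfin, hR⟩ := exists_finite_representatives hL hT hcat n
  refine ⟨Φ ∪ Formula.relabel (Fin.val : Fin n → ℕ) '' R, hΦ.union (hRfin.image _), fun φ => ?_⟩
  refine (hw φ).trans ?_
  rintro θ (hθ | hθ)
  · refine IsBasedOn.trans (fun η hη => ?_) hθ
    refine (isBasedOn_substitutions n hR hη).trans fun ζ hζ => ⟨ζ, .of ?_, Theory.Iff.refl _⟩
    exact Or.inr (substitutions_mono Set.subset_union_right hζ)
  · exact ⟨θ, .of (Or.inr (substitutions_mono Set.subset_union_left hθ)), Theory.Iff.refl _⟩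

theorem aar_eq_one {T : L.Theory} (h : AlmostAry T 1) : aar T = 1 := by
  refine le_antisymm (sInf_le ⟨1, le_rfl, h, by simp⟩) (le_sInf ?_)
  rintro _ ⟨n, hn, -, rfl⟩
  exact_mod_cast hn

end AlmostArity

theorem mainTheorem5 (L : FirstOrder.Language.{u, v}) (hL : L.card ≤ Cardinal.aleph0)
    (T : L.Theory) (hT : T.IsComplete) (hcat : (Cardinal.aleph0.{w}).Categorical T)
    (n : ℕ) (hn : AlmostArity.AlmostAry T n) :
    (∀ k : ℕ, 1 ≤ k → AlmostArity.AlmostAry T k) ∧ AlmostArity.aar T = 1 :=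
  ⟨fun k _ => hn.of_categorical hL hT hcat k,
    AlmostArity.aar_eq_one (hn.of_categorical hL hT hcat 1)⟩
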